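/- Consider a two-armed bandit in which the rewards $X_k(i)$ ($k=1,2$, $i\ge 1$; $X_k(i)$ is the reward of the $i$-th play of arm $k$) are independent, $X_k(i)\sim N(\mu_k,\sigma_0^2)$ with $\sigma_0^2>0$, and $\mu_1>\mu_2$, so that arm 2 is sub-optimal. Let $N_k(t)$ be the number of plays of arm $k$ up to and including time $t$, and $\widehat\mu_k(t)=\frac1{N_k(t)}\sum_{i=1}^{N_k(t)}X_k(i)$. The arms are selected by the KL-UCB algorithm for Gaussian rewards with assumed variance $\sigma^2>0$: each arm is played once in the first two rounds, and for every $t\ge 2$ the arm played at time $t+1$ maximizes the index $$U_k(t)=\sup\Big\{\mu\in\mathbb R:\ D\big(N(\widehat\mu_k(t),\sigma^2),N(\mu,\sigma^2)\big)\le \frac{\log t}{N_k(t)}\Big\},$$ where $D$ is the Kullback–Leibler divergence and ties are broken arbitrarily. Let $\mathbb P$ and $\mathbb E$ denote the resulting probability and expectation. Then for every $\gamma\in(0,1)$, $$\lim_{T\to\infty}\frac{\log \mathbb P(N_2(T)\ge x)}{\log x}=-\frac{\sigma^2}{\sigma_0^2}$$ uniformly for $x\in[\log^{1+\gamma}(T),(1-\gamma)T]$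 as $T\to\infty$. Moreover, if $\sigma_0^2>\sigma^2$, then for every $\delta\in(0,(\sigma_0^2/\sigma^2)-1)$, $$\liminf_{T\to\infty}\frac{\mathbb E[N_2(T)]}{T^{\,1-(1+\delta)\sigma^2/\sigma_0^2}}\ge 1.$$ -/

import Mathlib

open MeasureTheory ProbabilityTheory Filter
open scoped ENNReal NNReal Topology

namespace Bandit

noncomputable section

/-- `plays a k t` is `N_k(t)`: the number of times arm `k` is played up to and including time `t`,
when `a s` is the arm played at time `s = 1, 2, 3, …` (the value `a 0` is never used). The arms
`1` and `2` of the two-armed bandit are the elements `0` and `1` of `Fin 2`. -/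
def plays (a : ℕ → Fin 2) (k : Fin 2) (t : ℕ) : ℕ :=
  ((Finset.Icc 1 t).filter (fun s => a s = k)).card

/-- The sample mean of arm `k` up to time `t`, when `x k i` is the reward received at the
`(i + 1)`-th play of arm `k`: the average of the first `N_k(t)` rewards of arm `k`. -/
def sampleMean (x : Fin 2 → ℕ → ℝ) (a : ℕ → Fin 2) (k : Fin 2) (t : ℕ) : ℝ :=
  (∑ i ∈ Finset.range (plays a k t), x k i) / (plays a k t : ℝ)

/-- The Kullback-Leibler divergence of `N(m, σ²)` from `N(m', σ²)`. -/
def gaussianKL (σ m m' : ℝ) : ℝ≥0∞ :=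
  InformationTheory.klDiv (gaussianReal m (σ ^ 2).toNNReal) (gaussianReal m' (σ ^ 2).toNNReal)

/-- The index at time `t` of an arm that has been played `n` times with sample mean `m`, for the
KL-UCB algorithm designed for Gaussian rewards of variance `σ²`: the largest mean whose divergence
is at most `log t / n`. -/
def klucbIndex (σ m : ℝ) (n t : ℕ) : ℝ :=
  sSup {m' : ℝ | gaussianKL σ m m' ≤ ENNReal.ofReal (Real.log t / n)}

/-- The sequence of arms `a` is a run of KL-UCB for Gaussian rewards with assumed variance `σ²`,
on the reward table `x`: each arm is played once in the first two rounds, and for every `t ≥ 2`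
the arm played at time `t + 1` has maximal index at time `t` (ties are broken arbitrarily). -/
structure IsGaussianKLUCB (σ : ℝ) (x : Fin 2 → ℕ → ℝ) (a : ℕ → Fin 2) : Prop where
  init : ∀ k, plays a k 2 = 1
  step : ∀ t, 2 ≤ t → ∀ k,
    klucbIndex σ (sampleMean x a k t) (plays a k t) t ≤
      klucbIndex σ (sampleMean x a (a (t + 1)) t) (plays a (a (t + 1)) t) t

/-- `X k i` (the reward of the `(i + 1)`-th play of arm `k`) are independent Gaussian rewards, with
mean `μ k` for arm `k` and common variance `σ₀²`. -/
structure IsGaussianEnv {Ω : Type*} [MeasurableSpace Ω] (P : Measure Ω) (μ : Fin 2 → ℝ) (σ₀ : ℝ)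
    (X : Fin 2 → ℕ → Ω → ℝ) : Prop where
  law : ∀ k i, HasLaw (X k i) (gaussianReal (μ k) (σ₀ ^ 2).toNNReal) P
  indep : iIndepFun (fun (p : Fin 2 × ℕ) (ω : Ω) => X p.1 p.2 ω) P

end

end Bandit

/-!
Write `c = σ² / σ₀²` and `Δ = μ 0 - μ 1 > 0`. The divergence between two Gaussians of variance `σ²`
is half the squared distance of their means over `σ²` (`klDiv_gaussianReal`), so the index of an
arm with sample mean `m` after `n` plays is `m + σ √(2 log t / n)` (`klucbIndex_eq`). The
probability that arm `1` is played at least `x` times is then bounded on both sides by `x ^ (-c)`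
up to factors negligible on the logarithmic scale.

*Lower bound* (`exists_mul_rpow_le_measureReal`). If the very first reward of arm `0` falls below
its mean by a constant plus `σ √(2 log x)`, which has probability `x ^ (-c + o(1))` under variance
`σ₀²`, and the running means of arm `1` stay above a fixed level, which has probability at least
`1 / 2` independently of arm `0`, then arm `0` is not played again before arm `1` has been played
`x` times. Markov's inequality turns this into the bound on the expectation.

*Upper bound* (`exists_measureReal_le_mul_rpow`). Once `x` is a large multiple of `log T`, the bonus
of arm `1` after about `x` plays is small, and its mean is near `μ 1` outside an event of
probability exponentially small in `x`. So when arm `1` is played for the `⌈x⌉`-th time, some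
number `n` of plays of arm `0` has sample mean at most `μ 0 - Δ / 2 - σ √(2 log x / n)`.
Expanding the square in the Gaussian tail bound and dropping the cross term, the bonus gives
`x ^ (-c)` for every `n` and the gap gives a geometric series in `n`.

The condition `x ≥ (log T) ^ (1 + γ)` makes `x` dominate `log T`, and `x ≤ (1 - γ) T` leaves room
for the lower bound; both bounds otherwise involve `x` only, hence the uniformity.
-/

/-! ### The index of the algorithm -/

namespace Bandit

/-- The ratio of two Gaussian densities of equal variance is the exponential of an affine
function. -/
lemma gaussianReal_eq_withDensity_gaussianReal (m m' : ℝ) {v : ℝ≥0} (hv : v ≠ 0) :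
    gaussianReal m v = (gaussianReal m' v).withDensity
      (fun x => ENNReal.ofReal
        (Real.exp ((m - m') / v * x + (m' ^ 2 - m ^ 2) / (2 * v)))) := by
  have hv' : (v : ℝ) ≠ 0 := by exact_mod_cast hv
  rw [gaussianReal_of_var_ne_zero m hv, gaussianReal_of_var_ne_zero m' hv,
    ← withDensity_mul _ (measurable_gaussianPDF m' v) (by fun_prop)]
  congr 1
  ext x
  simp only [gaussianPDF, gaussianPDFReal, Pi.mul_apply]
  rw [← ENNReal.ofReal_mul (by positivity), mul_assoc _ (Real.exp _) (Real.exp _),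
    ← Real.exp_add]
  congr 3
  field_simp
  ring

lemma llr_gaussianReal_ae_eq (m m' : ℝ) {v : ℝ≥0} (hv : v ≠ 0) :
    llr (gaussianReal m v) (gaussianReal m' v) =ᵐ[gaussianReal m v]
      fun x => (m - m') / v * x + (m' ^ 2 - m ^ 2) / (2 * v) := by
  have hac : gaussianReal m v ≪ gaussianReal m' v :=
    (gaussianReal_absolutelyContinuous m hv).trans (gaussianReal_absolutelyContinuous' m' hv)
  have h : (gaussianReal m v).rnDeriv (gaussianReal m' v) =ᵐ[gaussianReal m' v]
      fun x => ENNReal.ofReal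
        (Real.exp ((m - m') / v * x + (m' ^ 2 - m ^ 2) / (2 * v))) := by
    conv_lhs => rw [gaussianReal_eq_withDensity_gaussianReal m m' hv]
    exact Measure.rnDeriv_withDensity _ (by fun_prop)
  filter_upwards [hac.ae_le h] with x hx
  rw [llr_def]
  simp only [hx]
  rw [ENNReal.toReal_ofReal (Real.exp_pos _).le, Real.log_exp]

lemma klDiv_gaussianReal (m m' : ℝ) {v : ℝ≥0} (hv : v ≠ 0) :
    InformationTheory.klDiv (gaussianReal m v) (gaussianReal m' v) =
      ENNReal.ofReal ((m - m') ^ 2 / (2 * v)) := by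
  have hv' : (v : ℝ) ≠ 0 := by exact_mod_cast hv
  have hac : gaussianReal m v ≪ gaussianReal m' v :=
    (gaussianReal_absolutelyContinuous m hv).trans (gaussianReal_absolutelyContinuous' m' hv)
  have hid : Integrable (fun x : ℝ => x) (gaussianReal m v) :=
    (memLp_id_gaussianReal 1).integrable le_rfl
  have hint : Integrable (fun x : ℝ => (m - m') / v * x + (m' ^ 2 - m ^ 2) / (2 * v))
      (gaussianReal m v) := (hid.const_mul _).add (integrable_const _)
  have hllr := llr_gaussianReal_ae_eq m m' hv
  rw [InformationTheory.klDiv_of_ac_of_integrable hac (hint.congr hllr.symm),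
    integral_congr_ae hllr, integral_add (hid.const_mul _) (integrable_const _),
    integral_const_mul, integral_id_gaussianReal]
  simp only [integral_const, probReal_univ, one_smul]
  congr 1
  field_simp
  ring

/-- The KL-UCB index for Gaussian rewards is the sample mean plus an explicit bonus. -/
lemma klucbIndex_eq {σ : ℝ} (hσ : 0 < σ) (m : ℝ) {n t : ℕ} (hn : 0 < n) (ht : 1 ≤ t) :
    klucbIndex σ m n t = m + σ * √(2 * Real.log t / n) := by
  have hn' : (0 : ℝ) < n := by exact_mod_cast hn
  have hlog : 0 ≤ Real.log t := Real.log_nonneg (by exact_mod_cast ht)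
  have hv : (σ ^ 2).toNNReal ≠ 0 := by
    rw [Ne, Real.toNNReal_eq_zero, not_le]
    positivity
  set s := √(2 * Real.log t / n) with hs
  have hs0 : 0 ≤ s := Real.sqrt_nonneg _
  have hs2 : s ^ 2 = 2 * Real.log t / n := Real.sq_sqrt (by positivity)
  have hset : {m' : ℝ | gaussianKL σ m m' ≤ ENNReal.ofReal (Real.log t / n)} =
      Set.Icc (m - σ * s) (m + σ * s) := by
    ext m'
    have hiff : (m - m') ^ 2 / (2 * σ ^ 2) ≤ Real.log t / n ↔ (m - m') ^ 2 ≤ (σ * s) ^ 2 := by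
      have : Real.log t / n = s ^ 2 / 2 := by rw [hs2]; ring
      rw [this, div_le_iff₀ (by positivity)]
      constructor <;> intro h <;> nlinarith
    simp only [gaussianKL, Set.mem_ofPred_eq, Set.mem_Icc]
    rw [klDiv_gaussianReal m m' hv, ENNReal.ofReal_le_ofReal_iff (by positivity),
      Real.coe_toNNReal _ (sq_nonneg σ), hiff, sq_le_sq, abs_of_nonneg (mul_nonneg hσ.le hs0),
      abs_le]
    constructor
    · rintro ⟨h1, h2⟩; constructor <;> linarith
    · rintro ⟨h1, h2⟩; constructor <;> linarith
  rw [klucbIndex, hset, csSup_Icc]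
  nlinarith [mul_nonneg hσ.le hs0]

/-! ### Runs of the algorithm on a fixed reward table -/

section Runs

variable {σ : ℝ} {x : Fin 2 → ℕ → ℝ} {a : ℕ → Fin 2}

lemma plays_succ (a : ℕ → Fin 2) (k : Fin 2) (t : ℕ) :
    plays a k (t + 1) = plays a k t + if a (t + 1) = k then 1 else 0 := by
  unfold plays
  rw [← Finset.insert_Icc_right_eq_Icc_add_one (by omega), Finset.filter_insert]
  split_ifs with h
  · rw [Finset.card_insert_of_notMem (by simp)]
  · simp

lemma plays_mono (a : ℕ → Fin 2) (k : Fin 2) : Monotone (plays a k) :=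
  monotone_nat_of_le_succ fun t => by rw [plays_succ]; omega

lemma plays_zero_add_plays_one (a : ℕ → Fin 2) (t : ℕ) : plays a 0 t + plays a 1 t = t := by
  induction t with
  | zero => simp [plays]
  | succ t ih =>
    rw [plays_succ, plays_succ]
    have h : a (t + 1) = 0 ∨ a (t + 1) = 1 := by omega
    rcases h with h | h <;> simp only [h] <;> simp <;> omega

/-- If the first reward of arm `0` is so low that its index stays below `c` up to time `M`, while
the sample means of arm `1` stay above `c`, then arm `0` is not played again up to time `M + 1`. -/
lemma IsGaussianKLUCB.plays_zero_eq_one (hσ : 0 < σ) (h : IsGaussianKLUCB σ x a) {M : ℕ} {c : ℝ}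
    (h0 : x 0 0 + σ * √(2 * Real.log M) < c)
    (h1 : ∀ n ∈ Finset.Icc 1 M, c * n ≤ ∑ i ∈ Finset.range n, x 1 i)
    {t : ℕ} (ht : 2 ≤ t) (htM : t ≤ M + 1) : plays a 0 t = 1 := by
  induction t, ht using Nat.le_induction with
  | base => exact h.init 0
  | succ t ht ih =>
    have hp0 := ih (by omega)
    have hp1 : plays a 1 t = t - 1 := by have := plays_zero_add_plays_one a t; omega
    rw [plays_succ, hp0, if_neg]
    intro ha
    have hstep := h.step t ht 1
    have hpos : (0 : ℝ) < ((t - 1 : ℕ) : ℝ) := by exact_mod_cast (by omega : 0 < t - 1)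
    rw [ha, hp0, hp1, klucbIndex_eq hσ _ (by omega) (by omega),
      klucbIndex_eq hσ _ (by omega) (by omega), sampleMean, sampleMean, hp0, hp1] at hstep
    simp only [Finset.sum_range_one, Nat.cast_one, div_one] at hstep
    have hmean : c ≤ (∑ i ∈ Finset.range (t - 1), x 1 i) / ((t - 1 : ℕ) : ℝ) := by
      rw [le_div_iff₀ hpos]
      exact h1 _ (Finset.mem_Icc.2 ⟨by omega, by omega⟩)
    have hsq : √(2 * Real.log t) ≤ √(2 * Real.log M) := by
      have : (0 : ℝ) < t := by exact_mod_cast (by omega : 0 < t)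
      have : (t : ℝ) ≤ M := by exact_mod_cast (by omega : t ≤ M)
      gcongr
    have hnn : 0 ≤ σ * √(2 * Real.log t / ((t - 1 : ℕ) : ℝ)) := by positivity
    nlinarith [mul_le_mul_of_nonneg_left hsq hσ.le]

/-- When arm `1` is played for the `(m + 1)`-st time, the index of arm `0` is at most that of
arm `1`; since the bonus of arm `1` is computed from `m` plays, this forces a sample mean of
arm `0` to be low. -/
lemma IsGaussianKLUCB.exists_low_index (hσ : 0 < σ) (h : IsGaussianKLUCB σ x a) {m T : ℕ}
    (hm : 2 ≤ m) (hT : m + 1 ≤ plays a 1 T) {b : ℝ}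
    (hb : (∑ i ∈ Finset.range m, x 1 i) / m + σ * √(2 * Real.log T / m) ≤ b) :
    ∃ n ∈ Finset.Icc 1 T,
      (∑ i ∈ Finset.range n, x 0 i) / n + σ * √(2 * Real.log (m + 1) / n) ≤ b := by
  classical
  have hex : ∃ s, m + 1 ≤ plays a 1 s := ⟨T, hT⟩
  -- `t + 1` is the time of the `(m + 1)`-st play of arm `1`.
  obtain ⟨t, ht⟩ : ∃ t, Nat.find hex = t + 1 := by
    refine Nat.exists_eq_succ_of_ne_zero fun h0 => ?_
    have := Nat.find_spec hex
    rw [h0] at this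
    simp [plays] at this
  have hspec : m + 1 ≤ plays a 1 (t + 1) := ht ▸ Nat.find_spec hex
  have hlt : plays a 1 t < m + 1 := by
    have := Nat.find_min hex (m := t) (by omega)
    omega
  have htT : t + 1 ≤ T := ht ▸ Nat.find_min' hex hT
  have hs := plays_succ a 1 t
  have ha : a (t + 1) = 1 := by
    by_contra hne
    rw [if_neg hne] at hs
    omega
  rw [if_pos ha] at hs
  have hp1 : plays a 1 t = m := by omega
  have hsum := plays_zero_add_plays_one a t
  have ht2 : 2 ≤ t := by omega
  have hp0 : 1 ≤ plays a 0 t := (h.init 0).symm.le.trans (plays_mono a 0 ht2)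
  have hstep := h.step t ht2 0
  rw [ha, hp1, klucbIndex_eq hσ _ (by omega) (by omega),
    klucbIndex_eq hσ _ (by omega) (by omega), sampleMean, sampleMean, hp1] at hstep
  refine ⟨plays a 0 t, Finset.mem_Icc.2 ⟨hp0, by omega⟩, ?_⟩
  have h1 : √(2 * Real.log (m + 1) / (plays a 0 t : ℝ)) ≤ √(2 * Real.log t / (plays a 0 t : ℝ)) := by
    have : (m + 1 : ℝ) ≤ t := by exact_mod_cast (by omega : m + 1 ≤ t)
    gcongr
  have h2 : √(2 * Real.log t / (m : ℝ)) ≤ √(2 * Real.log T / (m : ℝ)) := by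
    have : (0 : ℝ) < t := by exact_mod_cast (by omega : 0 < t)
    have : (t : ℝ) ≤ T := by exact_mod_cast (by omega : t ≤ T)
    gcongr
  nlinarith [mul_le_mul_of_nonneg_left h1 hσ.le, mul_le_mul_of_nonneg_left h2 hσ.le]

end Runs

end Bandit

/-! ### Gaussian tails and the reward table -/

namespace Bandit

section Env

variable {Ω : Type*} [MeasurableSpace Ω] {P : Measure Ω}
  {μ : Fin 2 → ℝ} {σ₀ : ℝ} {X : Fin 2 → ℕ → Ω → ℝ}

lemma hasSubgaussianMGF_of_hasLaw_gaussianReal {Y : Ω → ℝ} {m : ℝ} {v : ℝ≥0}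
    (hY : HasLaw Y (gaussianReal m v) P) : HasSubgaussianMGF (fun ω => Y ω - m) v P := by
  have h := gaussianReal_sub_const hY m
  rw [sub_self] at h
  rw [← HasSubgaussianMGF.id_map_iff h.aemeasurable, h.map_eq]
  refine ⟨fun t => integrable_exp_mul_gaussianReal t, fun t => ?_⟩
  rw [mgf_id_gaussianReal]
  simp

lemma IsGaussianEnv.indep_arm (hX : IsGaussianEnv P μ σ₀ X) (k : Fin 2) :
    iIndepFun (fun i ω => X k i ω - μ k) P :=
  (hX.indep.precomp (g := fun i : ℕ => (k, i)) fun i j h => (Prod.mk.inj h).2).comp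
    (fun _ y => y - μ k) fun _ => by fun_prop

lemma IsGaussianEnv.measureReal_sum_ge_le (hX : IsGaussianEnv P μ σ₀ X) (k : Fin 2) (n : ℕ)
    {ε : ℝ} (hε : 0 ≤ ε) :
    P.real {ω | n * (μ k + ε) ≤ ∑ i ∈ Finset.range n, X k i ω} ≤
      Real.exp (-(n * ε ^ 2 / (2 * σ₀ ^ 2))) := by
  have h := HasSubgaussianMGF.measure_sum_range_ge_le_of_iIndepFun (hX.indep_arm k) (n := n)
    (fun i _ => hasSubgaussianMGF_of_hasLaw_gaussianReal (hX.law k i))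
    (ε := n * ε) (by positivity)
  simp only [Finset.sum_sub_distrib, Finset.sum_const, Finset.card_range, nsmul_eq_mul,
    le_sub_iff_add_le] at h
  rw [Real.coe_toNNReal _ (sq_nonneg σ₀)] at h
  convert h using 2
  · simp only [mul_add, add_comm]
  · rcases eq_or_ne n 0 with rfl | hn
    · simp
    · field_simp

lemma IsGaussianEnv.measureReal_sum_le_le (hX : IsGaussianEnv P μ σ₀ X) (k : Fin 2) (n : ℕ)
    {ε : ℝ} (hε : 0 ≤ ε) :
    P.real {ω | ∑ i ∈ Finset.range n, X k i ω ≤ n * (μ k - ε)} ≤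
      Real.exp (-(n * ε ^ 2 / (2 * σ₀ ^ 2))) := by
  have hneg : IsGaussianEnv P (fun k => -μ k) σ₀ (fun k i ω => -X k i ω) :=
    ⟨fun k i => gaussianReal_neg (hX.law k i), hX.indep.comp (fun _ y => -y) fun _ => by fun_prop⟩
  refine le_of_eq_of_le ?_ (hneg.measureReal_sum_ge_le k n hε)
  congr 1
  ext ω
  simp only [Set.mem_ofPred_eq, Finset.sum_neg_distrib]
  constructor <;> intro h <;> linarith

/-- A Gaussian lower tail is at least the density at a point one unit further out. -/
lemma gaussianPDFReal_le_measureReal_Iic {m : ℝ} {v : ℝ≥0} (hv : v ≠ 0) {y : ℝ} (hy : y ≤ m) :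
    gaussianPDFReal m v (y - 1) ≤ (gaussianReal m v).real (Set.Iic y) := by
  have h1 : (gaussianReal m v).real (Set.Icc (y - 1) y) ≤ (gaussianReal m v).real (Set.Iic y) :=
    measureReal_mono Set.Icc_subset_Iic_self
  refine le_trans ?_ h1
  rw [measureReal_def, gaussianReal_apply_eq_integral m hv, ENNReal.toReal_ofReal
    (integral_nonneg fun _ => gaussianPDFReal_nonneg _ _ _)]
  have h2 := setIntegral_mono_on (μ := volume) (s := Set.Icc (y - 1) y)
    (f := fun _ => gaussianPDFReal m v (y - 1)) (g := gaussianPDFReal m v)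
    (by simp) (integrable_gaussianPDFReal m v).integrableOn measurableSet_Icc (by
      intro z hz
      simp only [gaussianPDFReal]
      have : (z - m) ^ 2 ≤ (y - 1 - m) ^ 2 := by nlinarith [hz.1, hz.2]
      gcongr)
  simpa using h2

lemma sum_Icc_pow_le {r : ℝ} (h0 : 0 ≤ r) (h1 : r < 1) (T : ℕ) :
    ∑ n ∈ Finset.Icc 1 T, r ^ n ≤ r / (1 - r) := by
  have h : ∀ T : ℕ, ∑ n ∈ Finset.Icc 1 T, r ^ n = (r - r ^ (T + 1)) / (1 - r) := by
    intro T
    have : 1 - r ≠ 0 := by linarith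
    induction T with
    | zero => simp
    | succ T ih =>
      rw [Finset.sum_Icc_succ_top (by omega), ih]
      field_simp
      ring
  rw [h]
  have := pow_nonneg h0 (T + 1)
  have : 0 < 1 - r := by linarith
  gcongr
  linarith

/-- The two events of the lower bound are independent, as they involve different arms. -/
lemma IsGaussianEnv.measureReal_inter_eq_mul (hX : IsGaussianEnv P μ σ₀ X) (c d : ℝ) (M : ℕ) :
    P.real ({ω | X 0 0 ω ≤ d} ∩
        {ω | ∀ n ∈ Finset.Icc 1 M, c * n ≤ ∑ i ∈ Finset.range n, X 1 i ω}) =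
      P.real {ω | X 0 0 ω ≤ d} *
        P.real {ω | ∀ n ∈ Finset.Icc 1 M, c * n ≤ ∑ i ∈ Finset.range n, X 1 i ω} := by
  set S : Finset (Fin 2 × ℕ) := {(0, 0)}
  set S' : Finset (Fin 2 × ℕ) := (Finset.range M).image (Prod.mk 1)
  have hS : Disjoint S S' := by simp [S, S']
  have hind := hX.indep.indepFun_finset₀ S S' hS fun p => (hX.law p.1 p.2).aemeasurable
  have hmem : ∀ n ∈ Finset.Icc 1 M, ∀ i : Finset.range n, ((1 : Fin 2), (i : ℕ)) ∈ S' := by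
    intro n hn i
    have := Finset.mem_range.1 i.2
    exact Finset.mem_image_of_mem _ (Finset.mem_range.2 (by have := (Finset.mem_Icc.1 hn).2; omega))
  have h := hind.measure_inter_preimage_eq_mul
    {f | f ⟨(0, 0), by simp [S]⟩ ≤ d}
    {g | ∀ n (hn : n ∈ Finset.Icc 1 M), c * n ≤
      ∑ i : Finset.range n, g ⟨((1 : Fin 2), (i : ℕ)), hmem n hn i⟩}
    (measurableSet_le (by fun_prop) (by fun_prop))
    (by
      simp only [Set.ofPred_forall]
      exact .iInter fun n => .iInter fun hn => measurableSet_le (by fun_prop) (by fun_prop))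
  simp only [Set.preimage_ofPred_eq,
    fun (n : ℕ) ω => Finset.sum_coe_sort (Finset.range n) (fun i => X 1 i ω)] at h
  rw [measureReal_def, h, ENNReal.toReal_mul]
  rfl

variable [IsProbabilityMeasure P]

/-- With probability at least `1 / 2`, all running means of an arm stay above its mean minus a
fixed multiple of the standard deviation. -/
lemma IsGaussianEnv.half_le_measureReal_sum_ge (hσ₀ : 0 < σ₀) (hX : IsGaussianEnv P μ σ₀ X)
    (k : Fin 2) (M : ℕ) :
    1 / 2 ≤ P.real {ω | ∀ n ∈ Finset.Icc 1 M,
      (μ k - σ₀ * √(2 * Real.log 3)) * n ≤ ∑ i ∈ Finset.range n, X k i ω} := by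
  -- the constant makes the `n`-th failure probability at most `3⁻ⁿ`, and `∑ 3⁻ⁿ = 1 / 2`
  set K := σ₀ * √(2 * Real.log 3) with hK
  set G := {ω | ∀ n ∈ Finset.Icc 1 M, (μ k - K) * n ≤ ∑ i ∈ Finset.range n, X k i ω} with hG
  have hlog : 0 < Real.log 3 := Real.log_pos (by norm_num)
  have hK2 : K ^ 2 / (2 * σ₀ ^ 2) = Real.log 3 := by
    rw [hK, mul_pow, Real.sq_sqrt (by positivity)]
    field_simp
  have hsub : Set.univ ⊆ G ∪ ⋃ n ∈ Finset.Icc 1 M,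
      {ω | ∑ i ∈ Finset.range n, X k i ω ≤ n * (μ k - K)} := by
    intro ω _
    by_cases h : ω ∈ G
    · exact Or.inl h
    · right
      simp only [hG, Set.mem_ofPred_eq, not_forall, not_le] at h
      obtain ⟨n, hn, h⟩ := h
      simp only [Set.mem_iUnion, Set.mem_ofPred_eq]
      exact ⟨n, hn, by linarith⟩
  have h1 := (measureReal_mono hsub (measure_ne_top P _)).trans (measureReal_union_le _ _)
  rw [probReal_univ] at h1
  have h2 : P.real (⋃ n ∈ Finset.Icc 1 M, {ω | ∑ i ∈ Finset.range n, X k i ω ≤ n * (μ k - K)})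
      ≤ 1 / 2 := by
    refine (measureReal_biUnion_finset_le _ _).trans ?_
    calc _ ≤ ∑ n ∈ Finset.Icc 1 M, (1 / 3 : ℝ) ^ n := by
          refine Finset.sum_le_sum fun n _ =>
            (hX.measureReal_sum_le_le k n (by positivity)).trans_eq ?_
          rw [mul_div_assoc, hK2, ← mul_neg, Real.exp_nat_mul, Real.exp_neg,
            Real.exp_log (by norm_num), one_div]
      _ ≤ (1 / 3) / (1 - 1 / 3) := sum_Icc_pow_le (by norm_num) (by norm_num) M
      _ = 1 / 2 := by norm_num
  linarith

end Env
end Bandit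

/-! ### Bounds for the number of plays of the sub-optimal arm -/

namespace Bandit

section Tails

variable {Ω : Type*} [MeasurableSpace Ω] {P : Measure Ω}
  {μ : Fin 2 → ℝ} {σ σ₀ : ℝ} {X : Fin 2 → ℕ → Ω → ℝ} {A : ℕ → Ω → Fin 2}

lemma IsGaussianEnv.exp_le_measureReal_le (hσ₀ : 0 < σ₀) (hX : IsGaussianEnv P μ σ₀ X)
    (k : Fin 2) (i : ℕ) {z : ℝ} (hz : 0 ≤ z) :
    (√(2 * Real.pi * σ₀ ^ 2))⁻¹ * Real.exp (-(z + 1) ^ 2 / (2 * σ₀ ^ 2)) ≤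
      P.real {ω | X k i ω ≤ μ k - z} := by
  have hv : (σ₀ ^ 2).toNNReal ≠ 0 := by
    rw [Ne, Real.toNNReal_eq_zero, not_le]
    positivity
  have h := gaussianPDFReal_le_measureReal_Iic hv (sub_le_self (μ k) hz)
  rw [← (hX.law k i).map_eq, map_measureReal_apply_of_aemeasurable (hX.law k i).aemeasurable
    measurableSet_Iic] at h
  refine le_of_eq_of_le ?_ h
  rw [gaussianPDFReal, Real.coe_toNNReal _ (sq_nonneg σ₀)]
  congr 4
  ring

variable [IsProbabilityMeasure P]

/-- The event that the first reward of arm `0` is very low and the running means of arm `1` are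
never too low has probability `x ^ (-σ² / σ₀² + o(1))`. On it, arm `1` is played at least `x`
times. -/
lemma exists_mul_rpow_le_measureReal (hσ : 0 < σ) (hσ₀ : 0 < σ₀) (hμ : μ 1 < μ 0)
    (hX : IsGaussianEnv P μ σ₀ X)
    (hπ : ∀ᵐ ω ∂P, IsGaussianKLUCB σ (fun k i => X k i ω) (fun t => A t ω))
    {η : ℝ} (hη : 0 < η) :
    ∃ C > 0, ∀ x : ℝ, 1 ≤ x → ∀ T : ℕ, x + 2 ≤ T →
      C * x ^ (-((1 + η) * (σ ^ 2 / σ₀ ^ 2))) ≤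
        P.real {ω | x ≤ (plays (fun t => A t ω) 1 T : ℝ)} := by
  set K := σ₀ * √(2 * Real.log 3) with hK
  have hK0 : 0 ≤ K := by positivity
  set B := μ 0 - μ 1 + K + 2 with hB
  set c := σ ^ 2 / σ₀ ^ 2 with hc
  set w := (√(2 * Real.pi * σ₀ ^ 2))⁻¹ with hw
  refine ⟨w * Real.exp (-((1 + η⁻¹) * B ^ 2 / (2 * σ₀ ^ 2) + (1 + η) * c * Real.log 2)) * (1 / 2),
    by positivity, fun x hx T hT => ?_⟩
  set M := ⌈x⌉₊ with hM
  have hxM : x ≤ M := Nat.le_ceil x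
  have hMx : (M : ℝ) < x + 1 := Nat.ceil_lt_add_one (by linarith)
  have hM1 : 1 ≤ M := by exact_mod_cast hx.trans hxM
  have hMT : M + 1 ≤ T := by
    have : ((M + 1 : ℕ) : ℝ) ≤ T := by push_cast; linarith
    exact_mod_cast this
  have hlogM : 0 ≤ Real.log M := Real.log_nonneg (by exact_mod_cast hM1)
  set s := σ * √(2 * Real.log M) with hs
  have hs0 : 0 ≤ s := by positivity
  have hs2 : s ^ 2 = 2 * σ ^ 2 * Real.log M := by
    rw [hs, mul_pow, Real.sq_sqrt (by positivity)]; ring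
  have hsub : ({ω | X 0 0 ω ≤ μ 0 - (B - 1 + s)} ∩
      {ω | ∀ n ∈ Finset.Icc 1 M, (μ 1 - K) * n ≤ ∑ i ∈ Finset.range n, X 1 i ω} : Set Ω) ≤ᵐ[P]
        ({ω | x ≤ (plays (fun t => A t ω) 1 T : ℝ)} : Set Ω) := by
    filter_upwards [hπ] with ω hω hmem
    obtain ⟨h0, h1⟩ := hmem
    have h0' : X 0 0 ω ≤ μ 0 - (B - 1 + s) := h0
    have hp0 := hω.plays_zero_eq_one hσ (M := M) (c := μ 1 - K) (by linarith) h1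
      (t := M + 1) (by omega) le_rfl
    have hadd := plays_zero_add_plays_one (fun t => A t ω) (M + 1)
    have hmono := plays_mono (fun t => A t ω) 1 hMT
    have : M ≤ plays (fun t => A t ω) 1 T := by omega
    exact hxM.trans (by exact_mod_cast this)
  have hle : P.real ({ω | X 0 0 ω ≤ μ 0 - (B - 1 + s)} ∩
      {ω | ∀ n ∈ Finset.Icc 1 M, (μ 1 - K) * n ≤ ∑ i ∈ Finset.range n, X 1 i ω}) ≤
        P.real {ω | x ≤ (plays (fun t => A t ω) 1 T : ℝ)} :=
    ENNReal.toReal_mono (measure_ne_top P _) (measure_mono_ae hsub)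
  rw [hX.measureReal_inter_eq_mul] at hle
  refine le_trans ?_ hle
  have hG := hX.half_le_measureReal_sum_ge hσ₀ 1 M
  have hL := hX.exp_le_measureReal_le hσ₀ 0 0 (z := B - 1 + s) (by linarith)
  refine le_trans ?_ (mul_le_mul hL hG (by norm_num) measureReal_nonneg)
  rw [mul_right_comm _ (1 / 2 : ℝ), mul_assoc w]
  refine mul_le_mul_of_nonneg_right (mul_le_mul_of_nonneg_left ?_ (by positivity)) (by norm_num)
  rw [Real.rpow_def_of_pos (by linarith), ← Real.exp_add]
  refine Real.exp_le_exp.2 ?_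
  have hlog : Real.log M ≤ Real.log 2 + Real.log x := by
    rw [← Real.log_mul (by norm_num) (by linarith)]
    exact Real.log_le_log (by exact_mod_cast hM1) (by linarith)
  -- `(B + s)² ≤ (1 + η⁻¹) B² + (1 + η) s²`, which keeps the cross term out of the exponent
  have hyoung : (B + s) ^ 2 ≤ (1 + η⁻¹) * B ^ 2 + (1 + η) * s ^ 2 := by
    have h1 : (1 + η⁻¹) * B ^ 2 + (1 + η) * s ^ 2 - (B + s) ^ 2 = η⁻¹ * (B - η * s) ^ 2 := by
      field_simp
      ring
    have h2 : 0 ≤ η⁻¹ * (B - η * s) ^ 2 := by positivity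
    linarith
  have hmain : (B + s) ^ 2 / (2 * σ₀ ^ 2) ≤
      (1 + η⁻¹) * B ^ 2 / (2 * σ₀ ^ 2) + (1 + η) * c * Real.log M := by
    have h1 : (1 + η⁻¹) * B ^ 2 / (2 * σ₀ ^ 2) + (1 + η) * c * Real.log M =
        ((1 + η⁻¹) * B ^ 2 + (1 + η) * s ^ 2) / (2 * σ₀ ^ 2) := by
      rw [hs2, hc]
      field_simp
    rw [h1]
    gcongr
  have hlog' : (1 + η) * c * Real.log M ≤ (1 + η) * c * (Real.log 2 + Real.log x) := by
    gcongr
  have e1 : -(B - 1 + s + 1) ^ 2 / (2 * σ₀ ^ 2) = -((B + s) ^ 2 / (2 * σ₀ ^ 2)) := by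
    rw [neg_div]; congr 3; ring
  rw [e1]
  linarith

/-- If arm `1` is played more than `m` times, then either its mean over the first `m` plays is
off by a constant, or some running mean of arm `0` is so low that its exploration bonus does not
lift it above the midpoint of the two means. The bonus contributes the factor
`(m + 1) ^ (-σ² / σ₀²)` to the probability of the latter, the gap a factor summable in the number
of plays of arm `0`. -/
lemma exists_measureReal_le_add (hσ : 0 < σ) (hσ₀ : 0 < σ₀) (hμ : μ 1 < μ 0)
    (hX : IsGaussianEnv P μ σ₀ X)
    (hπ : ∀ᵐ ω ∂P, IsGaussianKLUCB σ (fun k i => X k i ω) (fun t => A t ω)) :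
    ∃ C > 0, ∃ κ > 0, ∀ m T : ℕ, 2 ≤ m →
      32 * σ ^ 2 * Real.log T ≤ (μ 0 - μ 1) ^ 2 * m →
      P.real {ω | m + 1 ≤ plays (fun t => A t ω) 1 T} ≤
        Real.exp (-(κ * m)) + C * (m + 1 : ℝ) ^ (-(σ ^ 2 / σ₀ ^ 2)) := by
  set Δ := μ 0 - μ 1 with hΔ
  have hΔ0 : 0 < Δ := sub_pos.2 hμ
  set r := Real.exp (-(Δ ^ 2 / (8 * σ₀ ^ 2))) with hr
  have hr1 : r < 1 := by
    have : 0 < Δ ^ 2 / (8 * σ₀ ^ 2) := by positivity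
    rw [hr, ← Real.exp_zero]
    exact Real.exp_lt_exp.2 (by linarith)
  have hr0 : 0 < r := Real.exp_pos _
  have hr1' : 0 < 1 - r := by linarith
  refine ⟨r / (1 - r), by positivity, Δ ^ 2 / (32 * σ₀ ^ 2), by positivity,
    fun m T hm hT => ?_⟩
  have hm0 : (0 : ℝ) < m := by exact_mod_cast (by omega : 0 < m)
  have hlogm : 0 ≤ Real.log (m + 1) := Real.log_nonneg (by linarith)
  set s : ℕ → ℝ := fun n => σ * √(2 * Real.log (m + 1) / n) with hs
  set E₁ := {ω | m * (μ 1 + Δ / 4) ≤ ∑ i ∈ Finset.range m, X 1 i ω} with hE₁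
  set E₀ : ℕ → Set Ω :=
    fun n => {ω | ∑ i ∈ Finset.range n, X 0 i ω ≤ n * (μ 0 - (Δ / 2 + s n))} with hE₀
  -- the factor `32` in the hypothesis is what brings the bonus of arm `1` below `Δ / 4`, so that
  -- outside `E₁` the index of arm `1` is at most `μ 1 + Δ / 2 = μ 0 - Δ / 2`
  have hbonus : σ * √(2 * Real.log T / m) ≤ Δ / 4 := by
    have h1 : σ * √(2 * Real.log T / m) = √(σ ^ 2 * (2 * Real.log T / m)) := by
      rw [Real.sqrt_mul (sq_nonneg σ), Real.sqrt_sq hσ.le]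
    rw [h1, Real.sqrt_le_left (by positivity), ← mul_div_assoc, div_le_iff₀ hm0]
    nlinarith
  have hsub : ({ω | m + 1 ≤ plays (fun t => A t ω) 1 T} : Set Ω) ≤ᵐ[P]
      (E₁ ∪ ⋃ n ∈ Finset.Icc 1 T, E₀ n : Set Ω) := by
    filter_upwards [hπ] with ω hω hmem
    by_cases h1 : ω ∈ E₁
    · exact Or.inl h1
    right
    have h1' : ∑ i ∈ Finset.range m, X 1 i ω < m * (μ 1 + Δ / 4) := not_le.1 h1
    have hmean : (∑ i ∈ Finset.range m, X 1 i ω) / m ≤ μ 1 + Δ / 4 := by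
      rw [div_le_iff₀ hm0]; linarith
    obtain ⟨n, hn, hle⟩ := hω.exists_low_index hσ hm hmem (b := μ 0 - Δ / 2) (by linarith)
    have hn0 : (0 : ℝ) < n := by exact_mod_cast (Finset.mem_Icc.1 hn).1
    refine Set.mem_biUnion hn ?_
    have hle' : (∑ i ∈ Finset.range n, X 0 i ω) / n ≤ μ 0 - (Δ / 2 + s n) := by
      simp only [hs]; linarith
    rw [div_le_iff₀ hn0] at hle'
    simp only [hE₀, Set.mem_ofPred_eq]
    linarith
  have hle : P.real {ω | m + 1 ≤ plays (fun t => A t ω) 1 T} ≤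
      P.real (E₁ ∪ ⋃ n ∈ Finset.Icc 1 T, E₀ n) :=
    ENNReal.toReal_mono (measure_ne_top P _) (measure_mono_ae hsub)
  refine hle.trans ((measureReal_union_le _ _).trans (add_le_add ?_ ?_))
  · refine (hX.measureReal_sum_ge_le 1 m (by positivity)).trans_eq ?_
    congr 2
    field_simp
    norm_num
  · refine (measureReal_biUnion_finset_le _ _).trans ?_
    calc _ ≤ ∑ n ∈ Finset.Icc 1 T, r ^ n * (m + 1 : ℝ) ^ (-(σ ^ 2 / σ₀ ^ 2)) := by
          refine Finset.sum_le_sum fun n hn => ?_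
          have hn0 : (0 : ℝ) < n := by exact_mod_cast (Finset.mem_Icc.1 hn).1
          have hsn : 0 ≤ s n := by positivity
          have hsn2 : n * s n ^ 2 = 2 * σ ^ 2 * Real.log (m + 1) := by
            simp only [hs]
            rw [mul_pow, Real.sq_sqrt (by positivity)]
            field_simp
          refine (hX.measureReal_sum_le_le 0 n (by positivity)).trans ?_
          rw [hr, ← Real.exp_nat_mul, Real.rpow_def_of_pos (by positivity), ← Real.exp_add]
          refine Real.exp_le_exp.2 ?_
          have h1 : n * (Δ ^ 2 / (8 * σ₀ ^ 2)) + Real.log (m + 1) * (σ ^ 2 / σ₀ ^ 2) =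
              (n * (Δ / 2) ^ 2 + n * s n ^ 2) / (2 * σ₀ ^ 2) := by
            rw [hsn2]
            field_simp
            ring
          have h2 : (n * (Δ / 2) ^ 2 + n * s n ^ 2) / (2 * σ₀ ^ 2) ≤
              n * (Δ / 2 + s n) ^ 2 / (2 * σ₀ ^ 2) := by
            have : 0 ≤ n * (Δ * s n) := by positivity
            gcongr
            nlinarith
          linarith
      _ ≤ _ := by
          rw [← Finset.sum_mul]
          exact mul_le_mul_of_nonneg_right (sum_Icc_pow_le hr0.le hr1 T) (by positivity)

/-- The previous bound at `m + 1 = ⌈x⌉`, with its exponentially small term absorbed into the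
constant. -/
lemma exists_measureReal_le_mul_rpow (hσ : 0 < σ) (hσ₀ : 0 < σ₀) (hμ : μ 1 < μ 0)
    (hX : IsGaussianEnv P μ σ₀ X)
    (hπ : ∀ᵐ ω ∂P, IsGaussianKLUCB σ (fun k i => X k i ω) (fun t => A t ω)) :
    ∃ C > 0, ∃ x₀ : ℝ, ∀ x ≥ x₀, ∀ T : ℕ,
      32 * σ ^ 2 * Real.log T ≤ (μ 0 - μ 1) ^ 2 * (x - 1) →
      P.real {ω | x ≤ (plays (fun t => A t ω) 1 T : ℝ)} ≤ C * x ^ (-(σ ^ 2 / σ₀ ^ 2)) := by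
  obtain ⟨C, hC, κ, hκ, h⟩ := exists_measureReal_le_add hσ hσ₀ hμ hX hπ
  set c := σ ^ 2 / σ₀ ^ 2 with hc
  have hexp : ∀ᶠ x : ℝ in atTop, Real.exp (-(κ * x)) ≤ x ^ (-c) := by
    have := (isLittleO_exp_neg_mul_rpow_atTop hκ (-c)).bound one_pos
    filter_upwards [this, eventually_ge_atTop 0] with x hx hx0
    rw [one_mul, Real.norm_of_nonneg (Real.exp_pos _).le,
      Real.norm_of_nonneg (Real.rpow_nonneg hx0 _)] at hx
    simpa [neg_mul] using hx
  obtain ⟨x₀, hx₀⟩ := (hexp.and (eventually_ge_atTop 3)).exists_forall_of_atTop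
  refine ⟨Real.exp κ + C, by positivity, x₀, fun x hx T hT => ?_⟩
  obtain ⟨hxe, hx3⟩ := hx₀ x hx
  obtain ⟨m, hm⟩ : ∃ m, ⌈x⌉₊ = m + 1 :=
    Nat.exists_eq_succ_of_ne_zero (Nat.ceil_pos.2 (by linarith)).ne'
  have hxm : x ≤ m + 1 := by have := Nat.le_ceil x; rw [hm] at this; exact_mod_cast this
  have hm2 : 2 ≤ m := by
    have : ((2 : ℕ) : ℝ) ≤ m := by push_cast; linarith
    exact_mod_cast this
  have hset : {ω | x ≤ (plays (fun t => A t ω) 1 T : ℝ)} =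
      {ω | m + 1 ≤ plays (fun t => A t ω) 1 T} := by
    ext ω
    simp only [Set.mem_ofPred_eq, ← hm, Nat.ceil_le]
  rw [hset, add_mul]
  refine (h m T hm2 (hT.trans ?_)).trans (add_le_add ?_ ?_)
  · exact mul_le_mul_of_nonneg_left (by linarith) (sq_nonneg _)
  · calc Real.exp (-(κ * m)) ≤ Real.exp κ * Real.exp (-(κ * x)) := by
          rw [← Real.exp_add]
          exact Real.exp_le_exp.2 (by nlinarith)
      _ ≤ _ := by gcongr
  · refine mul_le_mul_of_nonneg_left ?_ hC.le
    exact Real.rpow_le_rpow_of_nonpos (by linarith) hxm (by rw [hc, neg_nonpos]; positivity)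

end Tails

end Bandit

/-! ### The tail exponent and the expectation -/

namespace Bandit

/-- Two-sided power bounds turn into a bound on the exponent as soon as `log x` dominates the
logarithms of the constants. -/
lemma abs_log_div_log_add_lt {p x c ε C₁ C₂ : ℝ} (hx : 1 < x) (hC₁ : 0 < C₁) (hC₂ : 0 < C₂)
    (hup : p ≤ C₁ * x ^ (-c)) (hlow : C₂ * x ^ (-(c + ε / 2)) ≤ p)
    (h₁ : Real.log C₁ < ε * Real.log x) (h₂ : -Real.log C₂ < ε / 2 * Real.log x) :
    |Real.log p / Real.log x - -c| < ε := by
  have hx0 : 0 < x := by linarith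
  have hL : 0 < Real.log x := Real.log_pos hx
  have hp : 0 < p := lt_of_lt_of_le (by positivity) hlow
  have hu := Real.log_le_log hp hup
  have hl := Real.log_le_log (by positivity) hlow
  rw [Real.log_mul hC₁.ne' (by positivity), Real.log_rpow hx0] at hu
  rw [Real.log_mul hC₂.ne' (by positivity), Real.log_rpow hx0] at hl
  rw [sub_neg_eq_add, div_add' _ _ _ hL.ne', abs_lt, lt_div_iff₀ hL, div_lt_iff₀ hL]
  constructor <;> linarith

end Bandit

theorem corollary1 {Ω : Type*} [MeasurableSpace Ω] (P : Measure Ω) [IsProbabilityMeasure P]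
    (σ σ₀ : ℝ) (hσ : 0 < σ) (hσ₀ : 0 < σ₀)
    (μ : Fin 2 → ℝ) (hμ : μ 1 < μ 0)
    (X : Fin 2 → ℕ → Ω → ℝ) (hX : Bandit.IsGaussianEnv P μ σ₀ X)
    (A : ℕ → Ω → Fin 2) (hA : ∀ t, Measurable (A t))
    (hπ : ∀ᵐ ω ∂P, Bandit.IsGaussianKLUCB σ (fun k i => X k i ω) (fun t => A t ω)) :
    (∀ γ ∈ Set.Ioo (0 : ℝ) 1, ∀ ε > 0, ∀ᶠ T : ℕ in atTop,
      ∀ x ∈ Set.Icc (Real.log T ^ (1 + γ)) ((1 - γ) * (T : ℝ)),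
        |Real.log (P.real {ω | x ≤ (Bandit.plays (fun t => A t ω) 1 T : ℝ)}) / Real.log x
          - (-(σ ^ 2 / σ₀ ^ 2))| < ε) ∧
    (σ ^ 2 < σ₀ ^ 2 → ∀ δ ∈ Set.Ioo (0 : ℝ) (σ₀ ^ 2 / σ ^ 2 - 1),
      1 ≤ liminf (fun T : ℕ =>
        (∫⁻ ω, (Bandit.plays (fun t => A t ω) 1 T : ℝ≥0∞) ∂P) /
          ENNReal.ofReal ((T : ℝ) ^ (1 - (1 + δ) * (σ ^ 2 / σ₀ ^ 2)))) atTop) := by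
  set c := σ ^ 2 / σ₀ ^ 2 with hc
  have hc0 : 0 < c := by positivity
  set Δ := μ 0 - μ 1 with hΔ
  have hΔ0 : 0 < Δ := sub_pos.2 hμ
  have hlogT : Tendsto (fun T : ℕ => Real.log T) atTop atTop :=
    Real.tendsto_log_atTop.comp tendsto_natCast_atTop_atTop
  refine ⟨fun γ hγ ε hε => ?_, fun _ δ hδ => ?_⟩
  · obtain ⟨C₁, hC₁, x₀, hup⟩ := Bandit.exists_measureReal_le_mul_rpow hσ hσ₀ hμ hX hπ
    obtain ⟨C₂, hC₂, hlow⟩ := Bandit.exists_mul_rpow_le_measureReal hσ hσ₀ hμ hX hπ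
      (η := ε / 2 / c) (by positivity)
    have hx_large : ∀ᶠ x : ℝ in atTop, x₀ ≤ x ∧ 1 < x ∧ Real.log C₁ < ε * Real.log x ∧
        -Real.log C₂ < ε / 2 * Real.log x :=
      (eventually_ge_atTop _).and <| (eventually_gt_atTop _).and <|
        ((Real.tendsto_log_atTop.const_mul_atTop hε).eventually_gt_atTop _).and
          ((Real.tendsto_log_atTop.const_mul_atTop (half_pos hε)).eventually_gt_atTop _)
    obtain ⟨x₁, hx₁⟩ := hx_large.exists_forall_of_atTop
    have hpow : Tendsto (fun T : ℕ => Real.log T ^ (1 + γ)) atTop atTop :=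
      (tendsto_rpow_atTop (by linarith [hγ.1])).comp hlogT
    have hpow' : Tendsto (fun T : ℕ => Real.log T ^ γ) atTop atTop :=
      (tendsto_rpow_atTop hγ.1).comp hlogT
    have hγT : Tendsto (fun T : ℕ => γ * (T : ℝ)) atTop atTop :=
      tendsto_natCast_atTop_atTop.const_mul_atTop hγ.1
    filter_upwards [hpow.eventually_ge_atTop x₁, hlogT.eventually_ge_atTop 1,
      hpow'.eventually_ge_atTop ((32 * σ ^ 2 + Δ ^ 2) / Δ ^ 2), hγT.eventually_ge_atTop 2]
      with T hT₁ hL hLγ hT₂ x hx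
    obtain ⟨hxx₀, hx1, h₁, h₂⟩ := hx₁ x (hT₁.trans hx.1)
    refine Bandit.abs_log_div_log_add_lt hx1 hC₁ hC₂ (hup x hxx₀ T ?_) ?_ h₁ h₂
    · have hsplit : Real.log T ^ (1 + γ) = Real.log T * Real.log T ^ γ := by
        rw [Real.rpow_add (by linarith), Real.rpow_one]
      rw [div_le_iff₀ (by positivity)] at hLγ
      have h := mul_le_mul_of_nonneg_left hLγ (by linarith : 0 ≤ Real.log T)
      have hx' := mul_le_mul_of_nonneg_left hx.1 (sq_nonneg Δ)
      rw [hsplit] at hx'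
      nlinarith [mul_le_mul_of_nonneg_left hL (sq_nonneg Δ)]
    · refine le_of_eq_of_le ?_ (hlow x hx1.le T (by linarith [hx.2]))
      rw [← hc, add_mul, one_mul, div_mul_cancel₀ _ hc0.ne']
  · have hδ0 : 0 < δ := hδ.1
    obtain ⟨C, hC, hlow⟩ := Bandit.exists_mul_rpow_le_measureReal hσ hσ₀ hμ hX hπ
      (η := δ / 2) (by positivity)
    have hpow : Tendsto (fun T : ℕ => (T : ℝ) ^ (δ / 2 * c)) atTop atTop :=
      (tendsto_rpow_atTop (by positivity)).comp tendsto_natCast_atTop_atTop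
    refine le_liminf_of_le (by isBoundedDefault) ?_
    filter_upwards [hpow.eventually_ge_atTop (2 / C), eventually_ge_atTop 4] with T hT hT4
    have hT4' : (4 : ℝ) ≤ T := by exact_mod_cast hT4
    have hT0 : (0 : ℝ) < T := by linarith
    rw [ENNReal.le_div_iff_mul_le (Or.inl (by simpa using by positivity))
      (Or.inl ENNReal.ofReal_ne_top), one_mul]
    -- Markov's inequality at level `T / 2`
    have hmeas : Measurable fun ω => (Bandit.plays (fun t => A t ω) 1 T : ℝ≥0∞) := by
      unfold Bandit.plays
      simp only [Finset.card_filter, Nat.cast_sum]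
      refine Finset.measurable_sum _ fun s _ => ?_
      exact (measurable_of_countable fun k : Fin 2 => (((if k = 1 then 1 else 0 : ℕ)) : ℝ≥0∞)).comp
        (hA s)
    refine le_trans ?_ (mul_meas_ge_le_lintegral hmeas (ENNReal.ofReal (T / 2)))
    have hset : {ω | ENNReal.ofReal (T / 2) ≤ (Bandit.plays (fun t => A t ω) 1 T : ℝ≥0∞)} =
        {ω | (T / 2 : ℝ) ≤ (Bandit.plays (fun t => A t ω) 1 T : ℝ)} := by
      ext ω
      simp only [Set.mem_ofPred_eq]
      rw [← ENNReal.ofReal_natCast, ENNReal.ofReal_le_ofReal_iff (Nat.cast_nonneg _)]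
    rw [hset, ← ofReal_measureReal, ← ENNReal.ofReal_mul (by positivity)]
    refine ENNReal.ofReal_le_ofReal ?_
    have h := hlow (T / 2) (by linarith) T (by linarith)
    refine le_trans ?_ (mul_le_mul_of_nonneg_left h (by positivity))
    -- passing from base `T / 2` to `T` is free since the exponent is negative
    have hmono : (T : ℝ) ^ (-((1 + δ / 2) * c)) ≤ (T / 2 : ℝ) ^ (-((1 + δ / 2) * c)) :=
      Real.rpow_le_rpow_of_nonpos (by linarith) (by linarith)
        (by rw [neg_nonpos]; positivity)
    refine le_trans ?_ (mul_le_mul_of_nonneg_left (mul_le_mul_of_nonneg_left hmono hC.le)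
      (by positivity))
    have hexp : (T : ℝ) * (T : ℝ) ^ (-((1 + δ / 2) * c)) =
        (T : ℝ) ^ (1 - (1 + δ) * c) * (T : ℝ) ^ (δ / 2 * c) := by
      nth_rewrite 1 [← Real.rpow_one (T : ℝ)]
      rw [← Real.rpow_add hT0, ← Real.rpow_add hT0]
      congr 1
      ring
    have hfac : (T : ℝ) / 2 * (C * (T : ℝ) ^ (-((1 + δ / 2) * c))) =
        (T : ℝ) ^ (1 - (1 + δ) * c) * (C / 2 * (T : ℝ) ^ (δ / 2 * c)) := by
      linear_combination C / 2 * hexp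
    rw [hfac]
    refine le_mul_of_one_le_right (by positivity) ?_
    rw [div_le_iff₀ hC] at hT
    linarith
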